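/- Let $\mathcal H=\bigotimes_{i=1}^m\mathcal H_i$ be a multipartite quantum system with $\mathcal H_i=\mathbb C^{d_i}$. A *product state* is a vector $\varphi_1\otimes\dots\otimes\varphi_m$ with unit vectors $\varphi_i\in\mathcal H_i$. An *unextendible product basis* (UPB) is a set $S\subset\mathcal H$ of mutually orthogonal product states whose span is a proper subspace of $\mathcal H$ and such that the orthogonal complement of this span contains no product state. A *protocol of local POVMs with classical communication* consists of finitely many rounds. In each round one party $i$, chosen depending on all earlier outcomes, performs on its own system a measurement with finitely many outcomes $a$, given by measurement operators $A_a$ from its current space to some finite-dimensional space with $\sum_a A_a^\dagger A_a=\mathbf 1$ (so that the operators $A_a^\dagger A_a$ form a POVM), and announces the outcome to all parties. The other parties may then apply local isometries depending on $a$. Outcome $a$ turns the (unnormalized) state $v$ into the state obtained by applying these local operators. At the end, depending on all outcomes, the parties announce a member of $S$. The protocol *perfectly distinguishes* the members of $S$ if, for every $\psi\in S$, when it is run on the state $\psi$ it announces $\psi$ with probability $1$. **Theorem.** If $S$ is a UPB in $\mathcal H$, then no protocol of local POVMs with classical communication perfectly distinguishes the members of $S$. -/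

import Mathlib

open scoped Matrix

noncomputable section

/-- The Hilbert space `⨂ⱼ ℂ^(d j)` of an `m`-partite quantum system with local dimensions `d j`,
written in the standard product basis, which is indexed by the multi-indices `x = (x j)ⱼ`. -/
abbrev MultipartiteSpace {m : ℕ} (d : Fin m → ℕ) : Type :=
  EuclideanSpace ℂ (∀ j, Fin (d j))

/-- The product vector `⨂ⱼ φ j`. -/
def productVector {m : ℕ} {d : Fin m → ℕ} (φ : ∀ j, EuclideanSpace ℂ (Fin (d j))) :
    MultipartiteSpace d :=
  WithLp.toLp 2 fun x => ∏ j, φ j (x j)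

/-- A pure product state: the tensor product of a unit vector of each party. -/
def IsProductState {m : ℕ} {d : Fin m → ℕ} (v : MultipartiteSpace d) : Prop :=
  ∃ φ : ∀ j, EuclideanSpace ℂ (Fin (d j)), (∀ j, ‖φ j‖ = 1) ∧ v = productVector φ

/-- An (incomplete orthogonal) product basis: a set of mutually orthogonal pure product states
that spans a proper subspace. -/
structure IsProductBasis {m : ℕ} {d : Fin m → ℕ} (S : Set (MultipartiteSpace d)) : Prop where
  productState : ∀ ψ ∈ S, IsProductState ψ
  orthogonal : ∀ ψ ∈ S, ∀ χ ∈ S, ψ ≠ χ → inner ℂ ψ χ = 0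
  proper : Submodule.span ℂ S ≠ ⊤

/-- An unextendible product basis: a product basis such that the orthogonal complement of its span
contains no product state. -/
structure IsUPB {m : ℕ} {d : Fin m → ℕ} (S : Set (MultipartiteSpace d)) : Prop
    extends IsProductBasis S where
  unextendible : ∀ v ∈ (Submodule.span ℂ S)ᗮ, ¬ IsProductState v

/-- The matrix of `⨂ⱼ A j`, where `A j` acts on the space of party `j`. -/
def productOperator {m : ℕ} {d e : Fin m → ℕ} (A : ∀ j, Matrix (Fin (e j)) (Fin (d j)) ℂ) :
    Matrix (∀ j, Fin (e j)) (∀ j, Fin (d j)) ℂ :=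
  Matrix.of fun x y => ∏ j, A j (x j) (y j)

/-- The (unnormalized) state vector `(⨂ⱼ A j) v`. -/
def applyLocal {m : ℕ} {d e : Fin m → ℕ} (A : ∀ j, Matrix (Fin (e j)) (Fin (d j)) ℂ)
    (v : MultipartiteSpace d) : MultipartiteSpace e :=
  WithLp.toLp 2 (productOperator A *ᵥ v.ofLp)

/-- A protocol of local POVMs with classical communication on a system with local dimensions `d`,
ending with the announcement of an element of `Ω`.

The protocol is a finite tree. It either stops and announces an element of `Ω`, or some party `i`
performs a POVM with finitely many outcomes `a` and announces the outcome. The measurement operator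
of outcome `a` is `A a i`, so that the POVM elements are `(A a i)ᴴ * A a i`. Every other party `j`
may react by a local isometry `A a j` (for instance the identity, a unitary, or the adjunction of
an ancilla), and everything that follows may depend on `a`. The local dimensions `e a` after the
round are arbitrary. Random choices are POVMs whose measurement operators are multiples of the
identity, and information is forgotten by continuing in the same way after several outcomes. -/
inductive LOCCProtocol {m : ℕ} (Ω : Type) : (Fin m → ℕ) → Type
  | announce {d : Fin m → ℕ} (ω : Ω) : LOCCProtocol Ω d
  | round {d : Fin m → ℕ} (i : Fin m) (k : ℕ) (e : Fin k → Fin m → ℕ)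
      (A : ∀ (a : Fin k) (j : Fin m), Matrix (Fin (e a j)) (Fin (d j)) ℂ)
      (povm : ∑ a, (A a i)ᴴ * A a i = 1)
      (isometry : ∀ a j, j ≠ i → (A a j)ᴴ * A a j = 1)
      (next : ∀ a, LOCCProtocol Ω (e a)) : LOCCProtocol Ω d

open Classical in
/-- The probability that the protocol announces `ω` when it is run on the unit vector `v`. For a
general `v` it is `‖v‖ ^ 2` times the probability for the normalized vector. By the Born rule,
`‖applyLocal (A a) v‖ ^ 2` is the probability of the outcome `a`. -/
def LOCCProtocol.prob {m : ℕ} {Ω : Type} :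
    {d : Fin m → ℕ} → LOCCProtocol Ω d → MultipartiteSpace d → Ω → ℝ
  | _, .announce ω', v, ω => if ω' = ω then ‖v‖ ^ 2 else 0
  | _, .round _ _ _ A _ _ next, v, ω => ∑ a, (next a).prob (applyLocal (A a) v) ω

/-- The members of `S` are perfectly distinguishable by local POVMs and classical communication:
some protocol identifies an unknown member of `S` with probability one. -/
def LOCCDistinguishable {m : ℕ} {d : Fin m → ℕ} (S : Set (MultipartiteSpace d)) : Prop :=
  ∃ P : LOCCProtocol S d, ∀ ψ : S, P.prob (ψ : MultipartiteSpace d) ψ = 1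

end

/-! Follow a run of the protocol while keeping a product subspace `⨂ W j` such that every member of
S either has all its factors in the `W j` or has some factor orthogonal to its `W j`, and such that
the local operators applied so far are multiples of isometries on each `W j`. By induction on the
protocol, every product vector of `⨂ W j` lies in the span of S; for the full spaces this
contradicts properness.

At a leaf at most one member survives, and unextendibility leaves only its multiples. In a round,
let E be the compression of `M† M` to `W i` for an outcome. Perfect discrimination keeps the
surviving members orthogonal, so replacing the factor `φ i` of a member by the part of `E φ i`
orthogonal to `φ i` gives a product vector orthogonal to all of S. By unextendibility this part
vanishes (`IsUPB.compressedGram_apply_factor`): each `φ i` is an eigenvector of E, and restricting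
`W i` to an eigenspace of nonzero eigenvalue restores the invariant. The operators E sum to a
nonzero scalar on `W i`, so a product vector outside the span would survive in some such eigenspace
(`exists_eigenvector_notMem_span`). -/

/-! ### Product vectors and unextendibility -/

section ProductVectors

variable {m : ℕ} {d e : Fin m → ℕ}

theorem inner_productVector (φ χ : ∀ j, EuclideanSpace ℂ (Fin (d j))) :
    inner ℂ (productVector φ) (productVector χ) = ∏ j, inner ℂ (φ j) (χ j) := by
  simp only [productVector, PiLp.inner_apply, RCLike.inner_apply, map_prod,
    ← Finset.prod_mul_distrib]
  exact (Fintype.prod_sum fun j (x : Fin (d j)) => χ j x * (starRingEnd ℂ) (φ j x)).symm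

theorem applyLocal_productVector (A : ∀ j, Matrix (Fin (e j)) (Fin (d j)) ℂ)
    (φ : ∀ j, EuclideanSpace ℂ (Fin (d j))) :
    applyLocal A (productVector φ) =
      productVector fun j => Matrix.toEuclideanLin (A j) (φ j) := by
  ext x
  simp only [applyLocal, productVector, productOperator, Matrix.mulVec, dotProduct,
    Matrix.of_apply, Matrix.toLpLin_apply, ← Finset.prod_mul_distrib]
  exact (Fintype.prod_sum fun j (y : Fin (d j)) => A j (x j) y * φ j y).symm

theorem productVector_update_apply (u : ∀ j, EuclideanSpace ℂ (Fin (d j))) (i : Fin m)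
    (v : EuclideanSpace ℂ (Fin (d i))) (x : ∀ j, Fin (d j)) :
    productVector (Function.update u i v) x =
      v (x i) * ∏ j ∈ Finset.univ.erase i, u j (x j) := by
  simp only [productVector]
  rw [← Finset.mul_prod_erase _ _ (Finset.mem_univ i), Function.update_self]
  refine congrArg _ <| Finset.prod_congr rfl fun j hj => ?_
  rw [Function.update_of_ne (Finset.ne_of_mem_erase hj)]

/-- The product vector as a linear function of the factor of party `i`. -/
noncomputable def productVectorLinear (u : ∀ j, EuclideanSpace ℂ (Fin (d j))) (i : Fin m) :
    EuclideanSpace ℂ (Fin (d i)) →ₗ[ℂ] MultipartiteSpace d where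
  toFun v := productVector (Function.update u i v)
  map_add' v w := by
    ext x
    simp only [PiLp.add_apply, productVector_update_apply, add_mul]
  map_smul' c v := by
    ext x
    simp only [PiLp.smul_apply, productVector_update_apply, smul_eq_mul, mul_assoc,
      RingHom.id_apply]

theorem productVectorLinear_apply (u : ∀ j, EuclideanSpace ℂ (Fin (d j))) (i : Fin m)
    (v : EuclideanSpace ℂ (Fin (d i))) :
    productVectorLinear u i v = productVector (Function.update u i v) := rfl

theorem productVector_smul (c : Fin m → ℂ) (φ : ∀ j, EuclideanSpace ℂ (Fin (d j))) :
    productVector (fun j => c j • φ j) = (∏ j, c j) • productVector φ := by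
  ext x
  simp [productVector, Finset.prod_mul_distrib]

theorem productVector_eq_zero_of_factor {φ : ∀ j, EuclideanSpace ℂ (Fin (d j))} (j : Fin m)
    (h : φ j = 0) : productVector φ = 0 := by
  ext x
  simpa [productVector] using Finset.prod_eq_zero (Finset.mem_univ j) (by simp [h])

/-- The orthogonal complement of a UPB contains no product vector with nonzero factors. -/
theorem IsUPB.exists_inner_ne_zero {S : Set (MultipartiteSpace d)} (hS : IsUPB S)
    (u : ∀ j, EuclideanSpace ℂ (Fin (d j))) (hu : ∀ j, u j ≠ 0) :
    ∃ ψ ∈ S, inner ℂ ψ (productVector u) ≠ 0 := by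
  by_contra! h
  refine hS.unextendible (productVector fun j => ((‖u j‖ : ℂ)⁻¹) • u j) ?_
    ⟨_, fun j => ?_, rfl⟩
  · rw [productVector_smul]
    refine Submodule.smul_mem _ _ ?_
    rw [Submodule.mem_orthogonal]
    intro w hw
    induction hw using Submodule.span_induction with
    | mem x hx => exact h x hx
    | zero => simp
    | add x y _ _ hx hy => rw [inner_add_left, hx, hy, add_zero]
    | smul c x _ hx => rw [inner_smul_left, hx, mul_zero]
  · exact norm_smul_inv_norm (hu j)

end ProductVectors

/-! ### Inner products under isometries and POVMs -/

theorem Matrix.inner_toEuclideanLin_toEuclideanLin {n k : ℕ} (A B : Matrix (Fin n) (Fin k) ℂ)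
    (x y : EuclideanSpace ℂ (Fin k)) :
    inner ℂ (Matrix.toEuclideanLin A x) (Matrix.toEuclideanLin B y) =
      inner ℂ x (Matrix.toEuclideanLin (Aᴴ * B) y) := by
  rw [← LinearMap.adjoint_inner_right, ← Matrix.toEuclideanLin_conjTranspose_eq_adjoint]
  simp [Matrix.toLpLin_apply, Matrix.mulVec_mulVec]

theorem Matrix.inner_toEuclideanLin_of_isometry {n k : ℕ} {A : Matrix (Fin n) (Fin k) ℂ}
    (hA : Aᴴ * A = 1) (x y : EuclideanSpace ℂ (Fin k)) :
    inner ℂ (Matrix.toEuclideanLin A x) (Matrix.toEuclideanLin A y) = inner ℂ x y := by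
  rw [Matrix.inner_toEuclideanLin_toEuclideanLin, hA]
  simp

theorem Matrix.sum_inner_toEuclideanLin_of_povm {K k : ℕ} {n : Fin K → ℕ}
    {A : ∀ a, Matrix (Fin (n a)) (Fin k) ℂ} (hA : ∑ a, (A a)ᴴ * A a = 1)
    (x y : EuclideanSpace ℂ (Fin k)) :
    ∑ a, inner ℂ (Matrix.toEuclideanLin (A a) x) (Matrix.toEuclideanLin (A a) y) =
      inner ℂ x y := by
  simp_rw [Matrix.inner_toEuclideanLin_toEuclideanLin]
  rw [← inner_sum, ← LinearMap.sum_apply, ← map_sum, hA]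
  simp

/-! ### Conservation of inner products in one round -/

section Round

variable {m : ℕ} {d : Fin m → ℕ} {i : Fin m} {k : ℕ} {e : Fin k → Fin m → ℕ}
  {A : ∀ (a : Fin k) (j : Fin m), Matrix (Fin (e a j)) (Fin (d j)) ℂ}

theorem sum_inner_applyLocal_productVector (povm : ∑ a, (A a i)ᴴ * A a i = 1)
    (isometry : ∀ a j, j ≠ i → (A a j)ᴴ * A a j = 1)
    (φ χ : ∀ j, EuclideanSpace ℂ (Fin (d j))) :
    ∑ a, inner ℂ (applyLocal (A a) (productVector φ)) (applyLocal (A a) (productVector χ)) =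
      inner ℂ (productVector φ) (productVector χ) := by
  simp_rw [applyLocal_productVector, inner_productVector,
    ← Finset.mul_prod_erase _ _ (Finset.mem_univ i)]
  rw [← Matrix.sum_inner_toEuclideanLin_of_povm povm, Finset.sum_mul]
  refine Finset.sum_congr rfl fun a _ => congrArg _ <| Finset.prod_congr rfl fun j hj => ?_
  exact Matrix.inner_toEuclideanLin_of_isometry (isometry a j (Finset.ne_of_mem_erase hj)) _ _

theorem sum_norm_applyLocal_productVector (povm : ∑ a, (A a i)ᴴ * A a i = 1)
    (isometry : ∀ a j, j ≠ i → (A a j)ᴴ * A a j = 1)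
    (φ : ∀ j, EuclideanSpace ℂ (Fin (d j))) :
    ∑ a, ‖applyLocal (A a) (productVector φ)‖ ^ 2 = ‖productVector φ‖ ^ 2 := by
  have h := sum_inner_applyLocal_productVector povm isometry φ φ
  simp_rw [inner_self_eq_norm_sq_to_K] at h
  exact_mod_cast h

end Round

/-! ### Consequences of certain announcement -/

namespace LOCCProtocol

variable {m : ℕ} {Ω : Type}

/-- A round preserves the total squared norm and keeps vectors product, so the bound passes up from
the leaves. -/
theorem prob_productVector_le {d : Fin m → ℕ} (P : LOCCProtocol Ω d)
    (φ : ∀ j, EuclideanSpace ℂ (Fin (d j))) (ω : Ω) :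
    P.prob (productVector φ) ω ≤ ‖productVector φ‖ ^ 2 := by
  induction P with
  | announce ω' =>
    rw [prob]
    split_ifs
    · exact le_rfl
    · positivity
  | round i k e A povm isometry next ih =>
    rw [prob, ← sum_norm_applyLocal_productVector povm isometry]
    refine Finset.sum_le_sum fun a _ => ?_
    rw [applyLocal_productVector]
    exact ih a _

/-- If a protocol surely announces `ω`, so do all its continuations after the first round. -/
theorem prob_next_eq {d : Fin m → ℕ} {i : Fin m} {k : ℕ} {e : Fin k → Fin m → ℕ}
    {A : ∀ (a : Fin k) (j : Fin m), Matrix (Fin (e a j)) (Fin (d j)) ℂ}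
    {povm : ∑ a, (A a i)ᴴ * A a i = 1} {isometry : ∀ a j, j ≠ i → (A a j)ᴴ * A a j = 1}
    {next : ∀ a, LOCCProtocol Ω (e a)} {φ : ∀ j, EuclideanSpace ℂ (Fin (d j))} {ω : Ω}
    (h : (round i k e A povm isometry next).prob (productVector φ) ω = ‖productVector φ‖ ^ 2)
    (a : Fin k) :
    (next a).prob (applyLocal (A a) (productVector φ)) ω =
      ‖applyLocal (A a) (productVector φ)‖ ^ 2 := by
  rw [prob, ← sum_norm_applyLocal_productVector povm isometry] at h
  -- Equal sums with termwise inequality force equality in every outcome.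
  refine (Finset.sum_eq_sum_iff_of_le fun a _ => ?_).1 h a (Finset.mem_univ a)
  rw [applyLocal_productVector]
  exact prob_productVector_le _ _ _

/-- Perfectly distinguished product vectors are orthogonal. -/
theorem inner_eq_zero_of_prob_eq {d : Fin m → ℕ} (P : LOCCProtocol Ω d)
    {φ χ : ∀ j, EuclideanSpace ℂ (Fin (d j))} {ω ω' : Ω} (hne : ω ≠ ω')
    (hφ : P.prob (productVector φ) ω = ‖productVector φ‖ ^ 2)
    (hχ : P.prob (productVector χ) ω' = ‖productVector χ‖ ^ 2) :
    inner ℂ (productVector φ) (productVector χ) = 0 := by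
  induction P with
  | announce η =>
    rw [prob] at hφ hχ
    by_cases h : η = ω
    · rw [if_neg (h ▸ hne)] at hχ
      rw [norm_eq_zero.1 (pow_eq_zero_iff two_ne_zero |>.1 hχ.symm), inner_zero_right]
    · rw [if_neg h] at hφ
      rw [norm_eq_zero.1 (pow_eq_zero_iff two_ne_zero |>.1 hφ.symm), inner_zero_left]
  | round i k e A povm isometry next ih =>
    rw [← sum_inner_applyLocal_productVector povm isometry]
    refine Finset.sum_eq_zero fun a _ => ?_
    have h₁ := prob_next_eq hφ a
    have h₂ := prob_next_eq hχ a
    rw [applyLocal_productVector] at h₁ h₂ ⊢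
    rw [applyLocal_productVector]
    exact ih a h₁ h₂

end LOCCProtocol

/-! ### Compressed POVM elements -/

section Compression

variable {E F : Type*} [NormedAddCommGroup E] [InnerProductSpace ℂ E] [FiniteDimensional ℂ E]
  [NormedAddCommGroup F] [InnerProductSpace ℂ F] [FiniteDimensional ℂ F]

/-- The compression to the subspace `W` of the positive operator `M† M`. -/
noncomputable def compressedGram (M : E →ₗ[ℂ] F) (W : Submodule ℂ E) : E →ₗ[ℂ] E :=
  W.starProjection.toLinearMap ∘ₗ M.adjoint ∘ₗ M ∘ₗ W.starProjection.toLinearMap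

theorem inner_compressedGram (M : E →ₗ[ℂ] F) (W : Submodule ℂ E) (x y : E) :
    inner ℂ x (compressedGram M W y) =
      inner ℂ (M (W.starProjection x)) (M (W.starProjection y)) := by
  simp only [compressedGram, LinearMap.comp_apply, ContinuousLinearMap.coe_coe]
  rw [← Submodule.inner_starProjection_left_eq_right, LinearMap.adjoint_inner_right]

theorem inner_compressedGram_of_mem (M : E →ₗ[ℂ] F) {W : Submodule ℂ E} {x y : E}
    (hx : x ∈ W) (hy : y ∈ W) :
    inner ℂ x (compressedGram M W y) = inner ℂ (M x) (M y) := by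
  rw [inner_compressedGram, Submodule.starProjection_eq_self_iff.2 hx,
    Submodule.starProjection_eq_self_iff.2 hy]

theorem compressedGram_isSymmetric (M : E →ₗ[ℂ] F) (W : Submodule ℂ E) :
    (compressedGram M W).IsSymmetric := by
  intro x y
  rw [inner_compressedGram, ← inner_conj_symm, inner_compressedGram, inner_conj_symm]

theorem compressedGram_mem (M : E →ₗ[ℂ] F) (W : Submodule ℂ E) (x : E) :
    compressedGram M W x ∈ W :=
  Submodule.starProjection_apply_mem _ _

/-- Eigenvalue 0 is excluded because the kernel contains `Wᗮ`; otherwise the eigenvector is a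
multiple of its image, which lies in `W`. -/
theorem mem_of_mem_eigenspace_compressedGram {M : E →ₗ[ℂ] F} {W : Submodule ℂ E} {c : ℂ}
    (hc : c ≠ 0) {x : E} (hx : x ∈ Module.End.eigenspace (compressedGram M W) c) : x ∈ W := by
  rw [Module.End.mem_eigenspace_iff] at hx
  exact (Submodule.smul_mem_iff _ hc).1 (hx ▸ compressedGram_mem M W x)

/-- The compressions of `Mₐ† Mₐ` sum to `c` on `W` if the `Mₐ` preserve inner products on `W` up
to the factor `c` in total. -/
theorem sum_compressedGram_apply {K : ℕ} {G : Fin K → Type*}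
    [∀ a, NormedAddCommGroup (G a)] [∀ a, InnerProductSpace ℂ (G a)]
    [∀ a, FiniteDimensional ℂ (G a)] {M : ∀ a, E →ₗ[ℂ] G a} {W : Submodule ℂ E} {c : ℂ}
    (h : ∀ x ∈ W, ∀ y ∈ W, ∑ a, inner ℂ (M a x) (M a y) = c * inner ℂ x y)
    {y : E} (hy : y ∈ W) : ∑ a, compressedGram (M a) W y = c • y := by
  have hW : ∑ a, compressedGram (M a) W y - c • y ∈ W :=
    W.sub_mem (W.sum_mem fun a _ => compressedGram_mem _ _ _) (W.smul_mem _ hy)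
  rw [← sub_eq_zero, ← inner_self_eq_zero (𝕜 := ℂ)]
  -- Only the second argument is expanded: the first must stay an element of `W` for `h` to apply.
  nth_rewrite 2 [sub_eq_add_neg]
  rw [inner_add_right, inner_neg_right, inner_sum, inner_smul_right, ← h _ hW _ hy]
  simp_rw [inner_compressedGram_of_mem (M _) hW hy]
  exact add_neg_cancel _

end Compression

/-! ### Unextendibility inside a compatible product subspace -/

section Unextendible

variable {m : ℕ} {d : Fin m → ℕ} {S : Set (MultipartiteSpace d)}
  {φ : S → ∀ j, EuclideanSpace ℂ (Fin (d j))}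
  {W : ∀ j, Submodule ℂ (EuclideanSpace ℂ (Fin (d j)))}

/-- Inside a product subspace that is compatible with a UPB, a product vector orthogonal to the
members of the UPB in that subspace has a vanishing factor. -/
theorem IsUPB.exists_factor_eq_zero (hS : IsUPB S)
    (hφ : ∀ ψ : S, (ψ : MultipartiteSpace d) = productVector (φ ψ))
    (hW : ∀ ψ, (∀ j, φ ψ j ∈ W j) ∨ ∃ j, φ ψ j ∈ (W j)ᗮ)
    {u : ∀ j, EuclideanSpace ℂ (Fin (d j))} (hu : ∀ j, u j ∈ W j)
    (h : ∀ ψ, (∀ j, φ ψ j ∈ W j) → ∏ j, inner ℂ (φ ψ j) (u j) = 0) : ∃ j, u j = 0 := by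
  by_contra! hne
  obtain ⟨ψ, hψ, hin⟩ := hS.exists_inner_ne_zero u hne
  apply hin
  rw [show ψ = productVector (φ ⟨ψ, hψ⟩) from hφ ⟨ψ, hψ⟩, inner_productVector]
  rcases hW ⟨ψ, hψ⟩ with hmem | ⟨j, hj⟩
  · exact h _ hmem
  · exact Finset.prod_eq_zero (Finset.mem_univ j)
      (Submodule.inner_left_of_mem_orthogonal (hu j) hj)

theorem prod_update_inner (i : Fin m) (χ u : ∀ j, EuclideanSpace ℂ (Fin (d j)))
    (r : EuclideanSpace ℂ (Fin (d i))) :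
    ∏ j, inner ℂ (χ j) (Function.update u i r j) =
      inner ℂ (χ i) r * ∏ j ∈ Finset.univ.erase i, inner ℂ (χ j) (u j) := by
  rw [← Finset.mul_prod_erase _ _ (Finset.mem_univ i), Function.update_self]
  refine congrArg _ <| Finset.prod_congr rfl fun j hj => ?_
  rw [Function.update_of_ne (Finset.ne_of_mem_erase hj)]

/-- Replacing one factor of a member of a UPB by a vector `r` orthogonal to it cannot produce
a vector orthogonal to the other members, unless `r = 0`. -/
theorem IsUPB.eq_zero_of_update (hS : IsUPB S)
    (hφ : ∀ ψ : S, (ψ : MultipartiteSpace d) = productVector (φ ψ))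
    (hnorm : ∀ ψ j, ‖φ ψ j‖ = 1)
    (hW : ∀ ψ, (∀ j, φ ψ j ∈ W j) ∨ ∃ j, φ ψ j ∈ (W j)ᗮ)
    {ψ : S} (hψ : ∀ j, φ ψ j ∈ W j) (i : Fin m) {r : EuclideanSpace ℂ (Fin (d i))}
    (hr : r ∈ W i) (hself : inner ℂ (φ ψ i) r = 0)
    (h : ∀ χ, χ ≠ ψ → (∀ j, φ χ j ∈ W j) →
      inner ℂ (φ χ i) r * ∏ j ∈ Finset.univ.erase i, inner ℂ (φ χ j) (φ ψ j) = 0) : r = 0 := by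
  obtain ⟨j, hj⟩ := hS.exists_factor_eq_zero hφ hW (u := Function.update (φ ψ) i r)
    (fun j => by
      rcases eq_or_ne j i with rfl | hj
      · simpa using hr
      · simpa [Function.update_of_ne hj] using hψ j)
    (fun χ hχ => by
      rw [prod_update_inner]
      rcases eq_or_ne χ ψ with rfl | hne
      · rw [hself, zero_mul]
      · exact h χ hne hχ)
  rcases eq_or_ne j i with rfl | hji
  · simpa using hj
  · rw [Function.update_of_ne hji] at hj
    simpa [hj] using hnorm ψ j

/-- A product subspace that contains at most one member of a UPB, and is compatible with it, lies
in the span of the UPB. -/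
theorem IsUPB.productVector_mem_span_of_subsingleton (hS : IsUPB S)
    (hφ : ∀ ψ : S, (ψ : MultipartiteSpace d) = productVector (φ ψ))
    (hnorm : ∀ ψ j, ‖φ ψ j‖ = 1)
    (hW : ∀ ψ, (∀ j, φ ψ j ∈ W j) ∨ ∃ j, φ ψ j ∈ (W j)ᗮ)
    {ω : S} (hω : ∀ ψ, (∀ j, φ ψ j ∈ W j) → ψ = ω)
    {u : ∀ j, EuclideanSpace ℂ (Fin (d j))} (hu : ∀ j, u j ∈ W j) :
    productVector u ∈ Submodule.span ℂ S := by
  by_cases hmem : ∀ j, φ ω j ∈ W j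
  -- The part of `u j` orthogonal to `φ ω j` vanishes, as no other member lies in the subspace.
  · have key : ∀ j, u j = (inner ℂ (φ ω j) (u j) : ℂ) • φ ω j := fun j => by
      rw [← sub_eq_zero]
      refine hS.eq_zero_of_update hφ hnorm hW hmem j
        ((W j).sub_mem (hu j) ((W j).smul_mem _ (hmem j))) ?_
        fun χ hχ hχW => absurd (hω χ hχW) hχ
      rw [inner_sub_right, inner_smul_right, inner_self_eq_norm_sq_to_K, hnorm]
      simp
    rw [funext key, productVector_smul, ← hφ]
    exact Submodule.smul_mem _ _ (Submodule.subset_span ω.2)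
  · obtain ⟨j, hj⟩ := hS.exists_factor_eq_zero hφ hW hu
      fun ψ hψ => absurd (hω ψ hψ ▸ hψ) hmem
    rw [productVector_eq_zero_of_factor j hj]
    exact Submodule.zero_mem _

/-- A local measurement operator that keeps the members of a UPB orthogonal has their local
factors as eigenvectors. -/
theorem IsUPB.compressedGram_apply_factor (hS : IsUPB S)
    (hφ : ∀ ψ : S, (ψ : MultipartiteSpace d) = productVector (φ ψ))
    (hnorm : ∀ ψ j, ‖φ ψ j‖ = 1)
    (hW : ∀ ψ, (∀ j, φ ψ j ∈ W j) ∨ ∃ j, φ ψ j ∈ (W j)ᗮ)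
    {i : Fin m} {n : ℕ} (M : EuclideanSpace ℂ (Fin (d i)) →ₗ[ℂ] EuclideanSpace ℂ (Fin n))
    (horth : ∀ χ ψ, χ ≠ ψ → (∀ j, φ χ j ∈ W j) → (∀ j, φ ψ j ∈ W j) →
      inner ℂ (M (φ χ i)) (M (φ ψ i)) *
        ∏ j ∈ Finset.univ.erase i, inner ℂ (φ χ j) (φ ψ j) = 0)
    {ψ : S} (hψ : ∀ j, φ ψ j ∈ W j) :
    compressedGram M (W i) (φ ψ i) =
      (inner ℂ (φ ψ i) (compressedGram M (W i) (φ ψ i)) : ℂ) • φ ψ i := by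
  rw [← sub_eq_zero]
  refine hS.eq_zero_of_update hφ hnorm hW hψ i
    ((W i).sub_mem (compressedGram_mem _ _ _) ((W i).smul_mem _ (hψ i))) ?_
    fun χ hχ hχW => ?_
  · rw [inner_sub_right, inner_smul_right, inner_self_eq_norm_sq_to_K, hnorm]
    simp
  -- Subtracting the multiple of `φ ψ i` does no harm, since S itself is orthogonal.
  · have h0 : inner ℂ (φ χ i) (φ ψ i) *
        ∏ j ∈ Finset.univ.erase i, inner ℂ (φ χ j) (φ ψ j) = 0 := by
      rw [Finset.mul_prod_erase _ (fun j => inner ℂ (φ χ j) (φ ψ j)) (Finset.mem_univ i),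
        ← inner_productVector, ← hφ, ← hφ]
      exact hS.orthogonal _ χ.2 _ ψ.2 fun h => hχ (Subtype.ext h)
    rw [inner_sub_right, inner_smul_right, sub_mul, mul_assoc, h0,
      inner_compressedGram_of_mem _ (hχW i) (hψ i), horth χ ψ hχ hχW hψ]
    simp

/-- A family of maps that together preserve inner products on `W i` up to a nonzero factor has
an eigenspace, for a nonzero eigenvalue, that is not contained in the span of `S`. -/
theorem exists_eigenvector_notMem_span {K : ℕ} {n : Fin K → ℕ} {i : Fin m}
    {M : ∀ a, EuclideanSpace ℂ (Fin (d i)) →ₗ[ℂ] EuclideanSpace ℂ (Fin (n a))} {c : ℂ}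
    (hc : c ≠ 0)
    (hM : ∀ x ∈ W i, ∀ y ∈ W i, ∑ a, inner ℂ (M a x) (M a y) = c * inner ℂ x y)
    {u : ∀ j, EuclideanSpace ℂ (Fin (d j))} (hu : ∀ j, u j ∈ W j)
    (huS : productVector u ∉ Submodule.span ℂ S) :
    ∃ a, ∃ μ : ℂ, μ ≠ 0 ∧ ∃ v ∈ Module.End.eigenspace (compressedGram (M a) (W i)) μ,
      productVector (Function.update u i v) ∉ Submodule.span ℂ S := by
  by_contra! h
  -- The eigenspaces span, and eigenvalue 0 contributes nothing to the image, so each compression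
  -- would map every vector into the preimage of the span.
  have htop : ∀ a, ((Submodule.span ℂ S).comap (productVectorLinear u i)).comap
      (compressedGram (M a) (W i)) = ⊤ := fun a => by
    have hsup : ⨆ μ, Module.End.eigenspace (compressedGram (M a) (W i)) μ = ⊤ := by
      rw [← Submodule.orthogonal_eq_bot_iff]
      exact (compressedGram_isSymmetric (M a) (W i)).orthogonalComplement_iSup_eigenspaces_eq_bot
    rw [eq_top_iff, ← hsup]
    refine iSup_le fun μ v hv => ?_
    rw [Submodule.mem_comap, Module.End.mem_eigenspace_iff.1 hv]
    by_cases hμ : μ = 0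
    · rw [hμ, zero_smul]
      exact Submodule.zero_mem _
    · exact Submodule.smul_mem _ _ (h a μ hμ v hv)
  have hsum : ∑ a, compressedGram (M a) (W i) (u i) ∈
      (Submodule.span ℂ S).comap (productVectorLinear u i) :=
    Submodule.sum_mem _ fun a _ => by
      rw [← Submodule.mem_comap, htop a]
      trivial
  rw [sum_compressedGram_apply hM (hu i), Submodule.smul_mem_iff _ hc, Submodule.mem_comap,
    productVectorLinear_apply, Function.update_eq_self] at hsum
  exact huS hsum

end Unextendible

/-! ### Induction on the protocol -/

/-- If a protocol distinguishes the images, under local operators that are multiples of isometries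
on `W j`, of the members of a UPB in a compatible product subspace `⨂ⱼ W j`, then this subspace
lies in the span of the UPB. -/
theorem IsUPB.productVector_mem_span_of_distinguished {m : ℕ} {d₀ : Fin m → ℕ} {S : Set (MultipartiteSpace d₀)}
    (hS : IsUPB S) {φ : S → ∀ j, EuclideanSpace ℂ (Fin (d₀ j))}
    (hφ : ∀ ψ : S, (ψ : MultipartiteSpace d₀) = productVector (φ ψ))
    (hnorm : ∀ ψ j, ‖φ ψ j‖ = 1)
    {d : Fin m → ℕ} (P : LOCCProtocol S d)
    (B : ∀ j, EuclideanSpace ℂ (Fin (d₀ j)) →ₗ[ℂ] EuclideanSpace ℂ (Fin (d j)))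
    (W : ∀ j, Submodule ℂ (EuclideanSpace ℂ (Fin (d₀ j)))) (c : Fin m → ℂ) (hc : ∀ j, c j ≠ 0)
    (hB : ∀ j, ∀ x ∈ W j, ∀ y ∈ W j, inner ℂ (B j x) (B j y) = c j * inner ℂ x y)
    (hW : ∀ ψ, (∀ j, φ ψ j ∈ W j) ∨ ∃ j, φ ψ j ∈ (W j)ᗮ)
    (hP : ∀ ψ, (∀ j, φ ψ j ∈ W j) →
      P.prob (productVector fun j => B j (φ ψ j)) ψ = ‖productVector fun j => B j (φ ψ j)‖ ^ 2)
    (u : ∀ j, EuclideanSpace ℂ (Fin (d₀ j))) (hu : ∀ j, u j ∈ W j) :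
    productVector u ∈ Submodule.span ℂ S := by
  induction P generalizing W c u with
  | announce ω =>
    refine hS.productVector_mem_span_of_subsingleton hφ hnorm hW (ω := ω) (fun ψ hψ => ?_) hu
    by_contra hne
    have h := hP ψ hψ
    rw [LOCCProtocol.prob, if_neg (Ne.symm hne)] at h
    -- A surviving member other than `ω` would have image zero, but its factors are only rescaled by
    -- the nonzero `c j`.
    have h0 := norm_eq_zero.1 (pow_eq_zero_iff two_ne_zero |>.1 h.symm)
    have h1 := inner_productVector (fun j => B j (φ ψ j)) (fun j => B j (φ ψ j))
    rw [h0, inner_zero_left] at h1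
    obtain ⟨j, -, hj⟩ := Finset.prod_eq_zero_iff.1 h1.symm
    rw [hB j _ (hψ j) _ (hψ j), inner_self_eq_norm_sq_to_K, hnorm] at hj
    simp [hc j] at hj
  | round i k e A povm isometry next ih =>
    by_contra huS
    have hnext : ∀ a ψ, (∀ j, φ ψ j ∈ W j) →
        (next a).prob (productVector fun j => (Matrix.toEuclideanLin (A a j) ∘ₗ B j) (φ ψ j)) ψ =
          ‖productVector fun j => (Matrix.toEuclideanLin (A a j) ∘ₗ B j) (φ ψ j)‖ ^ 2 := by
      intro a ψ hψ
      have h := LOCCProtocol.prob_next_eq (hP ψ hψ) a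
      rwa [applyLocal_productVector] at h
    have hiso : ∀ a j, j ≠ i → ∀ x ∈ W j, ∀ y ∈ W j,
        inner ℂ ((Matrix.toEuclideanLin (A a j) ∘ₗ B j) x)
          ((Matrix.toEuclideanLin (A a j) ∘ₗ B j) y) = c j * inner ℂ x y := by
      intro a j hj x hx y hy
      rw [← hB j x hx y hy]
      exact Matrix.inner_toEuclideanLin_of_isometry (isometry a j hj) _ _
    obtain ⟨a, μ, hμ, v, hv, hvS⟩ := exists_eigenvector_notMem_span (hc i)
      (M := fun a => Matrix.toEuclideanLin (A a i) ∘ₗ B i) (fun x hx y hy => by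
        rw [← hB i x hx y hy]
        exact Matrix.sum_inner_toEuclideanLin_of_povm povm _ _) hu huS
    set M := Matrix.toEuclideanLin (A a i) ∘ₗ B i
    have heig : ∀ ψ, (∀ j, φ ψ j ∈ W j) → _ := fun ψ hψ =>
      hS.compressedGram_apply_factor hφ hnorm hW M (fun χ ψ hne hχ hψ => by
        have h := (next a).inner_eq_zero_of_prob_eq hne (hnext a χ hχ) (hnext a ψ hψ)
        rw [inner_productVector, ← Finset.mul_prod_erase _ _ (Finset.mem_univ i),
          Finset.prod_congr rfl fun j hj =>
            hiso a j (Finset.ne_of_mem_erase hj) _ (hχ j) _ (hψ j),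
          Finset.prod_mul_distrib, mul_left_comm] at h
        -- The other parties contribute only nonzero scale factors, which cancel.
        exact (mul_eq_zero.1 h).resolve_left (Finset.prod_ne_zero_iff.2 fun j _ => hc j)) hψ
    set V := Module.End.eigenspace (compressedGram M (W i)) μ
    have hVW : V ≤ W i := fun x hx => mem_of_mem_eigenspace_compressedGram hμ hx
    have hle : ∀ j, Function.update W i V j ≤ W j := fun j => by
      rcases eq_or_ne j i with rfl | hj
      · simpa using hVW
      · simp [Function.update_of_ne hj]
    -- On `V` the compressed Gram operator is `μ`, so `M` scales inner products there by `μ`.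
    refine hvS (ih a (fun j => Matrix.toEuclideanLin (A a j) ∘ₗ B j) (Function.update W i V)
      (Function.update c i μ) (fun j => ?_) (fun j x hx y hy => ?_) (fun ψ => ?_)
      (fun ψ hψ => hnext a ψ fun j => hle j (hψ j)) _ (fun j => ?_))
    · rcases eq_or_ne j i with rfl | hj
      · simpa using hμ
      · simpa [Function.update_of_ne hj] using hc j
    · rcases eq_or_ne j i with rfl | hj
      · rw [Function.update_self] at hx hy ⊢
        rw [← inner_smul_right, ← Module.End.mem_eigenspace_iff.1 hy,
          inner_compressedGram_of_mem _ (hVW hx) (hVW hy)]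
      · rw [Function.update_of_ne hj] at hx hy ⊢
        exact hiso a j hj x hx y hy
    · rcases hW ψ with hψ | ⟨j, hj⟩
      · have hmem := Module.End.mem_eigenspace_iff.2 (heig ψ hψ)
        -- The eigenvalue decides: `μ` puts the factor in `V`, any other value makes it orthogonal
        -- to `V`.
        by_cases heq : inner ℂ (φ ψ i) (compressedGram M (W i) (φ ψ i)) = μ
        · rw [heq] at hmem
          refine Or.inl fun j => ?_
          rcases eq_or_ne j i with rfl | hj
          · rwa [Function.update_self]
          · simpa [Function.update_of_ne hj] using hψ j
        · refine Or.inr ⟨i, ?_⟩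
          rw [Function.update_self, Submodule.mem_orthogonal]
          intro w hw
          exact (compressedGram_isSymmetric M (W i)).orthogonalFamily_eigenspaces
            (Ne.symm heq) ⟨w, hw⟩ ⟨_, hmem⟩
      · exact Or.inr ⟨j, Submodule.orthogonal_le (hle j) hj⟩
    · rcases eq_or_ne j i with rfl | hj
      · simpa using hv
      · simpa [Function.update_of_ne hj] using hu j

/-! ### Contradiction with properness -/

theorem span_productVector_eq_top {m : ℕ} (d : Fin m → ℕ) :
    Submodule.span ℂ (Set.range (productVector (d := d))) = ⊤ := by
  rw [eq_top_iff, ← (EuclideanSpace.basisFun (∀ j, Fin (d j)) ℂ).toBasis.span_eq]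
  refine Submodule.span_mono ?_
  rintro _ ⟨x, rfl⟩
  refine ⟨fun j => EuclideanSpace.single (x j) 1, ?_⟩
  ext y
  simp [productVector, Finset.prod_ite_zero, funext_iff]

theorem theorem2 {m : ℕ} (d : Fin m → ℕ) (S : Set (MultipartiteSpace d)) (hS : IsUPB S) :
    ¬ LOCCDistinguishable S := by
  rintro ⟨P, hP⟩
  choose φ hnorm hφ using fun ψ : S => hS.productState ψ ψ.2
  have hone : ∀ ψ : S, ‖productVector (φ ψ)‖ ^ 2 = 1 := fun ψ => by
    have h := inner_productVector (φ ψ) (φ ψ)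
    simp_rw [inner_self_eq_norm_sq_to_K, hnorm, RCLike.ofReal_one, one_pow,
      Finset.prod_const_one] at h
    exact RCLike.ofReal_injective (K := ℂ) (by rw [RCLike.ofReal_pow, h, RCLike.ofReal_one])
  apply hS.proper
  rw [eq_top_iff, ← span_productVector_eq_top, Submodule.span_le]
  rintro _ ⟨u, rfl⟩
  refine hS.productVector_mem_span_of_distinguished hφ hnorm P
    (fun _ => LinearMap.id) (fun _ => ⊤) (fun _ => 1)
    (fun _ => one_ne_zero) (fun _ _ _ _ _ => by simp) (fun _ => Or.inl fun _ => trivial)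
    (fun ψ _ => ?_) u fun _ => trivial
  have h := hP ψ
  rw [hφ] at h
  exact h.trans (hone ψ).symm
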